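/- **Theorem (normal forms with respect to right equivalence).** Let $K$ be an algebraically closed field of arbitrary characteristic, $n\ge 1$, $K[[x]]=K[[x_1,\dots,x_n]]$, $\mathfrak m=\langle x_1,\dots,x_n\rangle$, and $j(f)=\langle \partial f/\partial x_1,\dots,\partial f/\partial x_n\rangle$ the Jacobian ideal of $f\in K[[x]]$. Two power series $f,g$ are right equivalent, $f\sim_r g$, if $f=\varphi(g)$ for some $K$-algebra automorphism $\varphi$ of $K[[x]]$. A $C$-polytope is a set $P=\{r\in\mathbb R_{\ge 0}^n \mid \lambda_P(r)=1\}$, where $\lambda_P(r)=\min_{1\le i\le s} w_i\cdot r$ for a nonempty finite set of weight vectors $w_1,\dots,w_s\in\mathbb Q_{>0}^n$ which is irredundant (no $w_i$ can be omitted without changing the minimum on $\mathbb R^n_{\ge 0}$). Let $N_P$ be the least common multiple of the denominators of all entries of the $w_i$. For $f=\sum_\alpha a_\alpha x^\alpha$ put $v_P(f)=\min\{N_P\lambda_P(\alpha)\mid a_\alpha\ne 0\}$, $v_P(0)=\infty$; let $\mathrm{In}_P(f)$ be the sum of the terms $a_\alpha x^\alpha$ with $a_\alpha\neq 0$ and $\lambda_P(\alpha)$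 minimal; and for a $K$-derivation $\xi=\sum_{i,\alpha} a_{i,\alpha}x^\alpha\partial_{x_i}$ of $K[[x]]$ put $v_P(\xi)=\min\{N_P\lambda_P(\alpha-e_i)\mid a_{i,\alpha}\ne 0\}$, $v_P(0)=\infty$. For $d\in\mathbb N$ let $$F_d=\{g\in K[[x]]\mid v_P(g)\ge d\},\qquad j_P^A(f)_d=\{\xi f\mid v_P(\xi)+v_P(f)\ge d\},\qquad \mathrm{gr}_P^A(M_f)=\bigoplus_{d\ge 0}F_d/\big(j_P^A(f)_d+F_{d+1}\big).$$ A set of monomials $\{x^\alpha\mid\alpha\in\Lambda\}$ is called a regular basis for $M_f$ if the classes of the $x^\alpha$, each taken in degree $v_P(x^\alpha)$, form a $K$-vector space basis of $\mathrm{gr}_P^A(M_f)$. Let $f\in\mathfrak m$, let $P$ be a $C$-polytope, and let $\{x^\alpha\mid \alpha\in\Lambda\}$ be a regular basis for $M_{\mathrm{In}_P(f)}$. If $k\in\mathbb N$ satisfies $\mathfrak m^{k+2}\subseteq \mathfrak m^2\cdot j(f)$, then the set $$\Lambda_f=\{\alpha\in\Lambda\mid \deg(x^\alpha)\le 2k-\mathrm{ord}(f)+2,\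 v_P(x^\alpha)\ge v_P(f-\mathrm{In}_P(f))\}$$ is finite, and there are $c_\alpha\in K$ ($\alpha\in\Lambda_f$) with $$f\ \sim_r\ \mathrm{In}_P(f)+\sum_{\alpha\in\Lambda_f}c_\alpha x^\alpha .$$ Here $\mathrm{ord}(f)$ is the order of $f$, i.e. the least total degree of a monomial occurring in $f$ (the hypothesis forces $f\ne 0$). -/

import Mathlib

noncomputable section

namespace NormalForms

open MvPowerSeries

/-- The `C`-polytope `P ⊆ ℝ_{≥0}^n`, presented by its (unique) irredundant finite set of weight
vectors with positive rational entries, one for each facet of `P`.  Irredundant: every weight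
vector is strictly smaller than all the others at some point of the positive orthant, so that it
cannot be omitted from the minimum which defines the piecewise linear function of `P`. -/
structure CPolytope (n : ℕ) where
  weights : Finset (Fin n → ℚ)
  nonempty : weights.Nonempty
  pos : ∀ w ∈ weights, ∀ j, 0 < w j
  irredundant : ∀ w ∈ weights, ∃ r : Fin n → ℝ, (∀ j, 0 ≤ r j) ∧
    ∀ w' ∈ weights, w' ≠ w → ∑ j, (w j : ℝ) * r j < ∑ j, (w' j : ℝ) * r j

namespace CPolytope

variable {n : ℕ} (P : CPolytope n)

/-- The piecewise linear function `λ_P : ℝ^n → ℝ`, the minimum of the linear functions given by the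
weight vectors. -/
def lam (r : Fin n → ℝ) : ℝ :=
  P.weights.inf' P.nonempty fun w => ∑ j, (w j : ℝ) * r j

/-- The underlying set `P = {r ∈ ℝ_{≥0}^n | λ_P(r) = 1}`. -/
def carrier : Set (Fin n → ℝ) := {r | (∀ j, 0 ≤ r j) ∧ P.lam r = 1}

/-- `N_P`, the least common multiple of the denominators of all entries of the weight vectors. -/
def N : ℕ := P.weights.lcm fun w => Finset.univ.lcm fun j => (w j).den

/-- `N_P · λ_P(r)`. -/
def val (r : Fin n → ℝ) : ℝ := (P.N : ℝ) * P.lam r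

/-- `N_P · λ_P(α)` for an exponent vector `α ∈ ℕ^n`. -/
def valExp (α : Fin n →₀ ℕ) : ℝ := P.val fun j => (α j : ℝ)

/-- `N_P · λ_P(α - e_i)`, the value of the monomial derivation `x^α ∂_i`. -/
def valDer (i : Fin n) (α : Fin n →₀ ℕ) : ℝ :=
  P.val fun j => (α j : ℝ) - if j = i then 1 else 0

lemma lam_mono {r s : Fin n → ℝ} (h : ∀ j, r j ≤ s j) : P.lam r ≤ P.lam s := by
  refine Finset.inf'_mono_fun fun w hw => Finset.sum_le_sum fun j _ => ?_
  exact mul_le_mul_of_nonneg_left (h j) (by exact_mod_cast (P.pos w hw j).le)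

lemma val_mono {r s : Fin n → ℝ} (h : ∀ j, r j ≤ s j) : P.val r ≤ P.val s :=
  mul_le_mul_of_nonneg_left (P.lam_mono h) (Nat.cast_nonneg _)

lemma exists_nat_eq_valExp (α : Fin n →₀ ℕ) : ∃ m : ℕ, P.valExp α = m := by
  obtain ⟨w, hw, h⟩ := Finset.exists_mem_eq_inf' P.nonempty
    fun w : Fin n → ℚ => ∑ j, (w j : ℝ) * (α j : ℝ)
  have key : ∀ j, ∃ m : ℕ, (P.N : ℚ) * w j = m := by
    intro j
    have h1 : (w j).den ∣ P.N :=
      (Finset.dvd_lcm (f := fun j => (w j).den) (Finset.mem_univ j)).trans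
        (Finset.dvd_lcm (f := fun w : Fin n → ℚ => Finset.univ.lcm fun j => (w j).den) hw)
    obtain ⟨c, hc⟩ := h1
    have h2 : (0 : ℤ) ≤ (w j).num := (Rat.num_pos.2 (P.pos w hw j)).le
    refine ⟨c * (w j).num.toNat, ?_⟩
    have h3 : (((w j).num.toNat : ℕ) : ℚ) = (w j).num := by
      exact_mod_cast Int.toNat_of_nonneg h2
    rw [hc]
    push_cast
    rw [h3, mul_assoc, mul_comm (c : ℚ), ← mul_assoc, Rat.den_mul_eq_num, mul_comm]
  choose m hm using key
  refine ⟨∑ j, m j * α j, ?_⟩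
  unfold valExp val lam
  rw [h, Finset.mul_sum]
  push_cast
  refine Finset.sum_congr rfl fun j _ => ?_
  rw [← mul_assoc]
  congr 1
  exact_mod_cast hm j

/-- The natural number `N_P · λ_P(α)`. -/
def natVal (α : Fin n →₀ ℕ) : ℕ := ⌊P.valExp α⌋₊

lemma natVal_cast (α : Fin n →₀ ℕ) : (P.natVal α : ℝ) = P.valExp α := by
  obtain ⟨m, hm⟩ := P.exists_nat_eq_valExp α
  simp [natVal, hm]

variable {K : Type*} [Field K]

/-- The piecewise valuation `v_P(f) = min {N_P · λ_P(α) | α ∈ supp f}`, with `v_P(0) = ⊤`. -/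
def v (f : MvPowerSeries (Fin n) K) : EReal :=
  ⨅ (α : Fin n →₀ ℕ) (_ : coeff α f ≠ 0), ((P.valExp α : ℝ) : EReal)

/-- The piecewise valuation of a derivation `ξ = ∑ a_{i,α} x^α ∂_i`, where `a_{i,α}` is the
coefficient of `x^α` in `ξ(x_i)`: the minimum of all `N_P · λ_P(α - e_i)` with `a_{i,α} ≠ 0`. -/
def vDer (ξ : Derivation K (MvPowerSeries (Fin n) K) (MvPowerSeries (Fin n) K)) : EReal :=
  ⨅ (i : Fin n) (α : Fin n →₀ ℕ) (_ : coeff α (ξ (X i)) ≠ 0), ((P.valDer i α : ℝ) : EReal)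

lemma v_monomial_one (α : Fin n →₀ ℕ) :
    P.v (monomial α (1 : K)) = ((P.natVal α : ℝ) : EReal) := by
  classical
  rw [natVal_cast]
  unfold v
  refine le_antisymm (iInf₂_le α (by simp)) (le_iInf₂ fun β hβ => ?_)
  rw [coeff_monomial] at hβ
  have : β = α := by
    by_contra h
    simp [h] at hβ
  rw [this]

lemma v_zero : P.v (0 : MvPowerSeries (Fin n) K) = ⊤ := by simp [v]

lemma v_ne_bot (f : MvPowerSeries (Fin n) K) : P.v f ≠ ⊥ := by
  have : (0 : EReal) ≤ P.v f := le_iInf₂ fun α _ => by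
    rw [← natVal_cast]
    exact_mod_cast Nat.cast_nonneg (α := ℝ) _
  exact (lt_of_lt_of_le EReal.bot_lt_zero this).ne'

lemma min_le_v_add (f g : MvPowerSeries (Fin n) K) : min (P.v f) (P.v g) ≤ P.v (f + g) := by
  refine le_iInf₂ fun α hα => ?_
  by_cases hf : coeff α f = 0
  · have hg : coeff α g ≠ 0 := by
      intro hg
      simp [hf, hg] at hα
    exact (min_le_right _ _).trans (iInf₂_le α hg)
  · exact (min_le_left _ _).trans (iInf₂_le α hf)

lemma exists_coeff_of_mul {f g : MvPowerSeries (Fin n) K} {α : Fin n →₀ ℕ}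
    (h : coeff α (g * f) ≠ 0) : ∃ β ≤ α, coeff β f ≠ 0 := by
  classical
  rw [coeff_mul] at h
  obtain ⟨p, hp, hne⟩ := Finset.exists_ne_zero_of_sum_ne_zero h
  refine ⟨p.2, ?_, right_ne_zero_of_mul hne⟩
  rw [← Finset.HasAntidiagonal.mem_antidiagonal.1 hp]
  exact le_add_self

lemma v_le_v_mul (g f : MvPowerSeries (Fin n) K) : P.v f ≤ P.v (g * f) := by
  refine le_iInf₂ fun α hα => ?_
  obtain ⟨β, hβ, hne⟩ := exists_coeff_of_mul hα
  refine (iInf₂_le β hne).trans ?_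
  exact_mod_cast P.val_mono fun j => by exact_mod_cast hβ j

lemma vDer_zero :
    P.vDer (0 : Derivation K (MvPowerSeries (Fin n) K) (MvPowerSeries (Fin n) K)) = ⊤ := by
  simp [vDer]

lemma min_le_vDer_add (ξ η : Derivation K (MvPowerSeries (Fin n) K) (MvPowerSeries (Fin n) K)) :
    min (P.vDer ξ) (P.vDer η) ≤ P.vDer (ξ + η) := by
  refine le_iInf fun i => le_iInf₂ fun α hα => ?_
  by_cases hf : coeff α (ξ (X i)) = 0
  · have hg : coeff α (η (X i)) ≠ 0 := by
      intro hg
      simp [hf, hg] at hα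
    exact (min_le_right _ _).trans ((iInf_le _ i).trans (iInf₂_le α hg))
  · exact (min_le_left _ _).trans ((iInf_le _ i).trans (iInf₂_le α hf))

lemma vDer_le_vDer_smul (g : MvPowerSeries (Fin n) K)
    (ξ : Derivation K (MvPowerSeries (Fin n) K) (MvPowerSeries (Fin n) K)) :
    P.vDer ξ ≤ P.vDer (g • ξ) := by
  refine le_iInf fun i => le_iInf₂ fun α hα => ?_
  rw [Derivation.smul_apply, smul_eq_mul] at hα
  obtain ⟨β, hβ, hne⟩ := exists_coeff_of_mul hα
  refine ((iInf_le _ i).trans (iInf₂_le β hne)).trans ?_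
  exact_mod_cast P.val_mono fun j => sub_le_sub_right (by exact_mod_cast hβ j) _

variable (K) in
/-- The filtration `F_d = {f | v_P(f) ≥ d}` by ideals. -/
def F (d : ℕ) : Ideal (MvPowerSeries (Fin n) K) where
  carrier := {f | ((d : ℝ) : EReal) ≤ P.v f}
  zero_mem' := by simp [v_zero]
  add_mem' {f g} hf hg := (le_min hf hg).trans (P.min_le_v_add f g)
  smul_mem' g f hf := le_trans (show ((d : ℝ) : EReal) ≤ P.v f from hf) (P.v_le_v_mul g f)

/-- The ideal `j_P^A(f)_d = {ξ f | v_P(ξ) + v_P(f) ≥ d}`, `ξ` ranging over all `K`-derivations of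
the power series ring. -/
def jA (f : MvPowerSeries (Fin n) K) (d : ℕ) : Ideal (MvPowerSeries (Fin n) K) where
  carrier := {h | ∃ ξ : Derivation K (MvPowerSeries (Fin n) K) (MvPowerSeries (Fin n) K),
    ((d : ℝ) : EReal) ≤ P.vDer ξ + P.v f ∧ h = ξ f}
  zero_mem' := ⟨0, by rw [vDer_zero, EReal.top_add_of_ne_bot (P.v_ne_bot f)]; exact le_top, by simp⟩
  add_mem' := by
    rintro _ _ ⟨ξ, hξ, rfl⟩ ⟨η, hη, rfl⟩
    refine ⟨ξ + η, ?_, by simp⟩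
    refine le_trans ?_ (add_le_add_left (P.min_le_vDer_add ξ η) (P.v f))
    rcases min_choice (P.vDer ξ) (P.vDer η) with h | h <;> rw [h] <;> assumption
  smul_mem' := by
    rintro g _ ⟨ξ, hξ, rfl⟩
    exact ⟨g • ξ, hξ.trans (add_le_add_left (P.vDer_le_vDer_smul g ξ) (P.v f)), by simp⟩

/-- The degree `d` part `F_d / (j_P^A(f)_d + F_{d+1})` of the graded space. -/
abbrev grPiece (f : MvPowerSeries (Fin n) K) (d : ℕ) : Type _ :=
  ↥(P.F K d) ⧸ (P.jA f d ⊔ P.F K (d + 1)).submoduleOf (P.F K d)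

/-- `gr_P^A(M_f) = ⨁_{d ≥ 0} F_d / (j_P^A(f)_d + F_{d+1})`, as a `K`-vector space. -/
abbrev grA (f : MvPowerSeries (Fin n) K) : Type _ :=
  DirectSum ℕ fun d => P.grPiece f d

/-- The class of the monomial `x^α` in `gr_P^A(M_f)`; it is homogeneous of degree `v_P(x^α)`. -/
def monomialClass (f : MvPowerSeries (Fin n) K) (α : Fin n →₀ ℕ) : P.grA f :=
  DirectSum.lof K ℕ (fun d => P.grPiece f d) (P.natVal α)
    (Submodule.Quotient.mk ⟨monomial α (1 : K), (P.v_monomial_one α).ge⟩)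

/-- `{x^α | α ∈ Λ}` is a regular basis for `M_f`: the classes of these monomials form a `K`-vector
space basis of `gr_P^A(M_f)`. -/
def IsRegularBasis (f : MvPowerSeries (Fin n) K) (Λ : Set (Fin n →₀ ℕ)) : Prop :=
  LinearIndependent K (fun α : Λ => P.monomialClass f α) ∧
    Submodule.span K (Set.range fun α : Λ => P.monomialClass f α) = ⊤

open Classical in
/-- The initial form `In_P(f)`: the sum of the terms `a_α x^α`, `α ∈ supp f`, for which `λ_P(α)` is
minimal. -/
def initialForm (f : MvPowerSeries (Fin n) K) : MvPowerSeries (Fin n) K := fun α =>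
  if ∀ β, coeff β f ≠ 0 → P.lam (fun j => (α j : ℝ)) ≤ P.lam (fun j => (β j : ℝ))
  then coeff α f else 0

/-- The exponents `α ∈ Λ` with `deg(x^α) ≤ 2k - ord(f) + 2` and `v_P(x^α) ≥ v_P(f - In_P(f))`.
The first inequality is written without subtraction. -/
def normalFormExponents (f : MvPowerSeries (Fin n) K) (Λ : Set (Fin n →₀ ℕ)) (k : ℕ) :
    Set (Fin n →₀ ℕ) :=
  {α ∈ Λ | (α.degree : ℕ∞) + f.order ≤ 2 * k + 2 ∧
    P.v (f - P.initialForm f) ≤ P.v (monomial α (1 : K))}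

end CPolytope

section

variable {n : ℕ} {K : Type*} [Field K]

variable (n K) in
/-- The maximal ideal `⟨x_1, …, x_n⟩` of the power series ring. -/
def maxIdeal : Ideal (MvPowerSeries (Fin n) K) :=
  Ideal.span (Set.range fun i : Fin n => (X i : MvPowerSeries (Fin n) K))

/-- The Jacobian ideal `j(f)`, generated by the partial derivatives of `f`. -/
def jacobianIdeal (f : MvPowerSeries (Fin n) K) : Ideal (MvPowerSeries (Fin n) K) :=
  Ideal.span (Set.range fun i : Fin n => pderiv K i f)

/-- Right equivalence: `f = φ(g)` for a `K`-algebra automorphism `φ` of the power series ring. -/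
def RightEquivalent (f g : MvPowerSeries (Fin n) K) : Prop :=
  ∃ φ : MvPowerSeries (Fin n) K ≃ₐ[K] MvPowerSeries (Fin n) K, f = φ g

end

end NormalForms

end

/-!
Normal forms of power series with respect to right equivalence, relative to a `C`-polytope `P`.

Every estimate rests on one Taylor expansion.  If a substitution `x_i ↦ x_i + h_i` raises the
`W`-weighted order of each variable by at least `e`, then it maps a series `g` of weighted order at
least `d` to `g + ∑ h_i ∂g/∂x_i` up to terms of order at least `d + 2 * e`
(`subst_sub_sub_mem_weightFiltration`).  It is checked on monomials by multiplicativity and involves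
no denominators, so that the characteristic does not matter.  For `e ≥ 1` such a substitution is an
automorphism, by completeness (`exists_algEquiv_eq_subst`).  The filtration `F_d` of `P` is the
intersection of the filtrations by weighted order for the weights `N_P · w` of its facets
(`mem_F_iff_forall_weights`), and the powers of the maximal ideal are the filtration for the weight
`(1, …, 1)` (`maxIdeal_pow_eq`); hence the expansion applies to both.

*Reduction along `P`.*  Write `q` for the initial form of `f` and `m` for `v_P(f)`.  If
`f = q + g + h` with `v_P(g) > m` and `v_P(h) ≥ D > m`, then the regular basis gives
`h = g' + ξ q + (terms of value > D)`, where `g'` is a combination of monomials of the basis of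
value `D`, and `v_P(ξ) ≥ D - m > 0`.  The automorphism `x_i ↦ x_i - ξ x_i` removes `ξ q` and changes
`f` otherwise only in values greater than `D` (`exists_algEquiv_sub_mem_F`).  After finitely many
such steps `f` is, modulo an arbitrarily high power of the maximal ideal, the initial form plus
monomials of the basis of value at least `v_P(f - q)`.

*Finite determinacy.*  If `𝔪 ^ (k + 2) ⊆ 𝔪 ^ 2 * j(f)`, then `f` is right
`(2 * k - ord f + 2)`-determined (`rightEquivalent_of_sub_mem`): a difference `g - f` of higher order
is `∑ h_i ∂f/∂x_i` with `h_i` of high order, the substitution `x_i ↦ x_i + h_i` brings `f` closer to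
`g`, and the composites of these substitutions converge.  The hypothesis is invariant under
automorphisms because the Jacobian ideal consists of the `ξ f`, `ξ` a derivation.

Determinacy, applied to the reduced series, removes the error term together with all monomials of
degree greater than `2 * k - ord f + 2`.
-/

noncomputable section

namespace NormalForms

open MvPowerSeries Finsupp

/-! ### The filtration by weighted order -/

section Filtration

variable {σ : Type*} {R : Type*} [CommRing R]

/-- The filtration of the power series ring by weighted order: `weightFiltration W d` is the ideal
of all power series each of whose monomials has `W`-weight at least `d`. -/
def weightFiltration (W : σ → ℕ) (d : ℕ) : Ideal (MvPowerSeries σ R) where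
  carrier := {f | ∀ α, coeff α f ≠ 0 → d ≤ weight W α}
  zero_mem' α h := absurd (map_zero _) h
  add_mem' {f g} hf hg α h := by
    by_cases h0 : coeff α f = 0
    · exact hg α fun h1 => h (by simp [h0, h1])
    · exact hf α h0
  smul_mem' g f hf α h := by
    classical
    rw [smul_eq_mul, coeff_mul] at h
    obtain ⟨p, hp, hne⟩ := Finset.exists_ne_zero_of_sum_ne_zero h
    rw [← Finset.HasAntidiagonal.mem_antidiagonal.1 hp, map_add]
    exact (hf _ (right_ne_zero_of_mul hne)).trans le_add_self

variable {W : σ → ℕ} {f g : MvPowerSeries σ R} {d e : ℕ}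

lemma mem_weightFiltration :
    f ∈ weightFiltration W d ↔ ∀ α, coeff α f ≠ 0 → d ≤ weight W α := Iff.rfl

lemma coeff_eq_zero_of_mem_weightFiltration (hf : f ∈ weightFiltration W d) {α : σ →₀ ℕ}
    (h : weight W α < d) : coeff α f = 0 := by
  by_contra h0
  exact absurd (hf α h0) (not_le.2 h)

lemma mem_weightFiltration_iff_le_weightedOrder :
    f ∈ weightFiltration W d ↔ (d : ℕ∞) ≤ f.weightedOrder W := by
  refine ⟨fun h => nat_le_weightedOrder W fun α => coeff_eq_zero_of_mem_weightFiltration h,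
    fun h α hα => ?_⟩
  exact_mod_cast h.trans (weightedOrder_le W hα)

lemma mem_weightFiltration_one_iff_le_order :
    f ∈ weightFiltration (fun _ => 1) d ↔ (d : ℕ∞) ≤ f.order :=
  mem_weightFiltration_iff_le_weightedOrder

lemma weightFiltration_anti (h : d ≤ e) :
    (weightFiltration W e : Ideal (MvPowerSeries σ R)) ≤ weightFiltration W d :=
  fun _ hf α hα => h.trans (hf α hα)

lemma mem_weightFiltration_zero (f : MvPowerSeries σ R) : f ∈ weightFiltration W 0 :=
  fun _ _ => Nat.zero_le _

lemma mul_mem_weightFiltration (hf : f ∈ weightFiltration W d) (hg : g ∈ weightFiltration W e) :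
    f * g ∈ weightFiltration W (d + e) := by
  rw [mem_weightFiltration_iff_le_weightedOrder] at *
  rw [Nat.cast_add]
  exact (add_le_add hf hg).trans (le_weightedOrder_mul W)

lemma smul_mem_weightFiltration (c : R) (hf : f ∈ weightFiltration W d) :
    c • f ∈ weightFiltration W d := by
  rw [smul_eq_C_mul]
  exact Ideal.mul_mem_left _ _ hf

lemma monomial_mem_weightFiltration {α : σ →₀ ℕ} (c : R) (h : d ≤ weight W α) :
    monomial α c ∈ weightFiltration W d := by
  classical
  intro β hβ
  rw [coeff_monomial] at hβ
  have : β = α := by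
    by_contra h'
    simp [h'] at hβ
  rwa [this]

lemma eq_zero_of_forall_mem_weightFiltration (h : ∀ d, f ∈ weightFiltration W d) : f = 0 := by
  ext α
  exact coeff_eq_zero_of_mem_weightFiltration (h (weight W α + 1)) (Nat.lt_succ_self _)

lemma eq_of_forall_sub_mem_weightFiltration (h : ∀ d, f - g ∈ weightFiltration W d) : f = g :=
  sub_eq_zero.1 (eq_zero_of_forall_mem_weightFiltration h)

/-- The power series ring is complete for the weight filtration. -/
lemma exists_limit_weightFiltration (W : σ → ℕ) (u : ℕ → MvPowerSeries σ R)
    (hu : ∀ j, u (j + 1) - u j ∈ weightFiltration W (j + 1)) :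
    ∃ f, ∀ j, f - u j ∈ weightFiltration W (j + 1) := by
  have hcoeff : ∀ j m α, weight W α ≤ j → coeff α (u (j + m)) = coeff α (u j) := by
    intro j m α hα
    induction m with
    | zero => rfl
    | succ m ih =>
      rw [← ih, ← sub_eq_zero, ← map_sub]
      exact coeff_eq_zero_of_mem_weightFiltration (hu (j + m)) (by omega)
  let L : MvPowerSeries σ R := fun α => coeff α (u (weight W α))
  have hL : ∀ α, coeff α L = coeff α (u (weight W α)) := fun _ => rfl
  refine ⟨L, fun j α hα => ?_⟩
  by_contra! hlt
  refine hα ?_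
  obtain ⟨m, rfl⟩ := Nat.exists_eq_add_of_le (Nat.lt_succ_iff.1 hlt)
  rw [map_sub, hcoeff _ m α le_rfl, hL, sub_self]

/-- The inverse is the geometric series in `ψ - id`. -/
lemma bijective_of_sub_mem_weightFiltration (W : σ → ℕ)
    (ψ : MvPowerSeries σ R →ₐ[R] MvPowerSeries σ R)
    (hψ : ∀ d, ∀ p ∈ weightFiltration W d, ψ p - p ∈ weightFiltration W (d + 1)) :
    Function.Bijective ψ := by
  refine ⟨(injective_iff_map_eq_zero ψ).2 fun p hp => ?_, fun q => ?_⟩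
  · refine eq_zero_of_forall_mem_weightFiltration (W := W) fun d => ?_
    induction d with
    | zero => exact mem_weightFiltration_zero p
    | succ d ih => simpa [hp] using hψ d p ih
  · -- the approximations `u (j + 1) = u j + (q - ψ (u j))` of a preimage of `q`
    let u : ℕ → MvPowerSeries σ R := fun j => Nat.rec 0 (fun _ p => p + (q - ψ p)) j
    have hu : ∀ j, u (j + 1) = u j + (q - ψ (u j)) := fun _ => rfl
    have hq : ∀ j, q - ψ (u j) ∈ weightFiltration W j := by
      intro j
      induction j with
      | zero => exact mem_weightFiltration_zero _
      | succ j ih =>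
        have := hψ j _ ih
        rw [hu, map_add]
        convert neg_mem this using 1
        ring
    have hcauchy : ∀ j, u (j + 1 + 1) - u (j + 1) ∈ weightFiltration W (j + 1) := by
      intro j
      rw [hu (j + 1), add_sub_cancel_left]
      exact hq (j + 1)
    obtain ⟨p, hp⟩ := exists_limit_weightFiltration W (fun j => u (j + 1)) hcauchy
    refine ⟨p, eq_of_forall_sub_mem_weightFiltration (W := W) fun d => ?_⟩
    have h1 := add_mem (weightFiltration_anti (Nat.le_succ _) (hψ _ _ (hp d))) (hp d)
    rw [sub_add_cancel, map_sub] at h1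
    have h2 := sub_mem h1 (hq (d + 1))
    rw [show ψ p - ψ (u (d + 1)) - (q - ψ (u (d + 1))) = ψ p - q by ring] at h2
    exact weightFiltration_anti (Nat.le_succ _) h2

/-- A sequence of algebra endomorphisms which is Cauchy for the weight filtration converges to an
algebra endomorphism. -/
lemma exists_algHom_limit (W : σ → ℕ) (Φ : ℕ → MvPowerSeries σ R →ₐ[R] MvPowerSeries σ R)
    (hΦ : ∀ j p, Φ (j + 1) p - Φ j p ∈ weightFiltration W (j + 1)) :
    ∃ Ψ : MvPowerSeries σ R →ₐ[R] MvPowerSeries σ R,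
      ∀ j p, Ψ p - Φ j p ∈ weightFiltration W (j + 1) := by
  choose L hL using fun p => exists_limit_weightFiltration W (fun j => Φ j p) fun j => hΦ j p
  have huniq : ∀ p q, (∀ j, q - Φ j p ∈ weightFiltration W (j + 1)) → L p = q := by
    intro p q hq
    refine eq_of_forall_sub_mem_weightFiltration (W := W) fun d => ?_
    have := sub_mem (hL p d) (hq d)
    rw [sub_sub_sub_cancel_right] at this
    exact weightFiltration_anti (Nat.le_succ _) this
  refine ⟨AlgHom.ofLinearMap
    { toFun := L
      map_add' := fun p q => huniq _ _ fun j => ?_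
      map_smul' := fun c p => huniq _ _ fun j => ?_ } (huniq _ _ fun j => ?_)
      fun p q => huniq _ _ fun j => ?_, fun j p => hL p j⟩
  · rw [map_add, add_sub_add_comm]
    exact add_mem (hL p j) (hL q j)
  · rw [map_smul, RingHom.id_apply, ← smul_sub]
    exact smul_mem_weightFiltration c (hL p j)
  · simp
  · have h1 := add_mem (Ideal.mul_mem_right (L q) _ (hL p j))
      (Ideal.mul_mem_left _ (Φ j p) (hL q j))
    convert h1 using 1
    rw [map_mul]
    change L p * L q - _ = _
    ring

lemma subst_mem_weightFiltration {a : σ → MvPowerSeries σ R} (ha : HasSubst a)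
    (h : ∀ i, a i ∈ weightFiltration W (W i)) {g : MvPowerSeries σ R}
    (hg : g ∈ weightFiltration W d) : subst a g ∈ weightFiltration W d := by
  rw [mem_weightFiltration_iff_le_weightedOrder]
  refine le_trans (le_iInf₂ fun α hα => ?_) (le_weightedOrder_subst W ha g)
  refine le_trans (Nat.cast_le.2 (hg α hα)) ?_
  rw [weight_apply, weight_apply, Finsupp.sum, Finsupp.sum, Nat.cast_sum]
  refine Finset.sum_le_sum fun i _ => ?_
  rw [smul_eq_mul, Nat.cast_mul, nsmul_eq_mul]
  exact mul_le_mul_right (mem_weightFiltration_iff_le_weightedOrder.1 (h i)) _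

lemma mul_pderiv_mem_weightFiltration {i : σ} {g h : MvPowerSeries σ R}
    (hh : h ∈ weightFiltration W (W i + e)) (hg : g ∈ weightFiltration W d) :
    h * pderiv R i g ∈ weightFiltration W (d + e) := by
  classical
  intro γ hγ
  rw [coeff_mul] at hγ
  obtain ⟨p, hp, hne⟩ := Finset.exists_ne_zero_of_sum_ne_zero hγ
  have h1 := hh _ (left_ne_zero_of_mul hne)
  have h2 := right_ne_zero_of_mul hne
  rw [coeff_pderiv] at h2
  have h3 := hg _ (left_ne_zero_of_mul h2)
  rw [← Finset.HasAntidiagonal.mem_antidiagonal.1 hp, map_add]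
  rw [map_add, weight_single, one_smul] at h3
  omega

end Filtration

/-! ### Taylor expansion of substitutions -/

section Taylor

variable {σ : Type*} [Fintype σ] {R : Type*} [CommRing R] {W : σ → ℕ} {d e : ℕ}

lemma sum_mul_pderiv_mem_weightFiltration {g : MvPowerSeries σ R} {h : σ → MvPowerSeries σ R}
    (hh : ∀ i, h i ∈ weightFiltration W (W i + e)) (hg : g ∈ weightFiltration W d) :
    ∑ i, h i * pderiv R i g ∈ weightFiltration W (d + e) :=
  sum_mem fun i _ => mul_pderiv_mem_weightFiltration (hh i) hg

/-- A power series of weighted order at least `d` is, modulo high weighted order, a finite sum of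
monomials of weight at least `d`. -/
lemma exists_polynomial_sub_mem_weightFiltration (hW : ∀ i, W i ≠ 0) (f : MvPowerSeries σ R)
    (M : ℕ) : ∃ s : Finset (σ →₀ ℕ),
      f - ∑ α ∈ s, coeff α f • monomial α (1 : R) ∈ weightFiltration W M := by
  classical
  refine ⟨(finite_of_nat_weight_lt W hW M).toFinset, fun α hα => ?_⟩
  by_contra! hlt
  refine hα ?_
  rw [map_sub, map_sum, Finset.sum_eq_single α]
  · simp
  · intro β _ hβ
    simp [coeff_monomial, hβ.symm]
  · simp [hlt]

/-- **Taylor expansion**, to first order, of a substitution `x_i ↦ x_i + h_i` which raises the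
weighted order of each variable by at least `e`: the remainder has order raised by `2 * e`.  No
division by integers occurs, so that this holds in every characteristic. -/
lemma subst_sub_sub_mem_weightFiltration (hW : ∀ i, W i ≠ 0) {a : σ → MvPowerSeries σ R}
    (ha : HasSubst a) (h : ∀ i, a i - X i ∈ weightFiltration W (W i + e))
    {g : MvPowerSeries σ R} (hg : g ∈ weightFiltration W d) :
    subst a g - g - ∑ i, (a i - X i) * pderiv R i g ∈ weightFiltration W (d + 2 * e) := by
  classical
  have haW : ∀ i, a i ∈ weightFiltration W (W i) := by
    intro i
    have h1 : (X i : MvPowerSeries σ R) ∈ weightFiltration W (W i) :=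
      monomial_mem_weightFiltration _ (by rw [weight_single, one_smul])
    simpa using add_mem (weightFiltration_anti (Nat.le_add_right _ _) (h i)) h1
  set φ := substAlgHom (R := R) ha with hφ
  have hφW : ∀ {d p}, p ∈ weightFiltration W d → φ p ∈ weightFiltration W d := by
    intro d p hp
    rw [hφ, substAlgHom_apply]
    exact subst_mem_weightFiltration ha haW hp
  let D : Derivation R (MvPowerSeries σ R) (MvPowerSeries σ R) :=
    ∑ i, (a i - X i) • pderiv R i
  have hD : ∀ p, D p = ∑ i, (a i - X i) * pderiv R i p := by
    intro p
    change Derivation.coeFnAddMonoidHom D p = _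
    rw [map_sum, Finset.sum_apply]
    rfl
  have hDW : ∀ {d p}, p ∈ weightFiltration W d → D p ∈ weightFiltration W (d + e) := by
    intro d p hp
    rw [hD]
    exact sum_mul_pderiv_mem_weightFiltration h hp
  let T : MvPowerSeries σ R →ₗ[R] MvPowerSeries σ R := φ.toLinearMap - LinearMap.id - D.toLinearMap
  have hT : ∀ p, T p = φ p - p - D p := fun p => rfl
  have hTmul : ∀ {d d' p q}, p ∈ weightFiltration W d → q ∈ weightFiltration W d' →
      T p ∈ weightFiltration W (d + 2 * e) → T q ∈ weightFiltration W (d' + 2 * e) →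
      T (p * q) ∈ weightFiltration W (d + d' + 2 * e) := by
    intro d d' p q hp hq hTp hTq
    have h0 : T (p * q) = T p * φ q + p * T q + D p * (T q + D q) := by
      simp only [hT, map_mul, Derivation.leibniz, smul_eq_mul]
      ring
    rw [h0]
    refine add_mem (add_mem ?_ ?_) ?_
    · exact weightFiltration_anti (by omega) (mul_mem_weightFiltration hTp (hφW hq))
    · exact weightFiltration_anti (by omega) (mul_mem_weightFiltration hp hTq)
    · exact weightFiltration_anti (by omega) (mul_mem_weightFiltration (hDW hp)
        (add_mem (weightFiltration_anti (by omega) hTq) (hDW hq)))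
  have hTmon : ∀ α, T (monomial α 1) ∈ weightFiltration W (weight W α + 2 * e) := by
    have hstep : ∀ α β, T (monomial α 1) ∈ weightFiltration W (weight W α + 2 * e) →
        T (monomial β 1) ∈ weightFiltration W (weight W β + 2 * e) →
        T (monomial (α + β) 1) ∈ weightFiltration W (weight W (α + β) + 2 * e) := by
      intro α β hα hβ
      have := hTmul (monomial_mem_weightFiltration 1 le_rfl)
        (monomial_mem_weightFiltration 1 le_rfl) hα hβ
      rwa [monomial_mul_monomial, one_mul, ← map_add] at this
    have hzero : T (monomial 0 1) = 0 := by
      have : (monomial 0 1 : MvPowerSeries σ R) = 1 := rfl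
      rw [this, hT, map_one, Derivation.map_one_eq_zero, sub_self, sub_zero]
    intro α
    induction α using Finsupp.induction_linear with
    | zero => rw [hzero]; exact zero_mem _
    | add α β hα hβ => exact hstep α β hα hβ
    | single i k =>
      induction k with
      | zero => rw [single_zero, hzero]; exact zero_mem _
      | succ k ih =>
        rw [single_add]
        refine hstep _ _ ih ?_
        have : T (X i) = 0 := by
          rw [hT, hφ, substAlgHom_X, hD, Finset.sum_eq_single i]
          · simp
          · intro j _ hj
            rw [pderiv_X_of_ne hj.symm, mul_zero]
          · simp
        rw [show (monomial (single i 1) 1 : MvPowerSeries σ R) = X i from rfl, this]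
        exact zero_mem _
  have hmain : T g ∈ weightFiltration W (d + 2 * e) := by
    obtain ⟨s, hs⟩ := exists_polynomial_sub_mem_weightFiltration hW g (d + 2 * e)
    rw [← sub_add_cancel g (∑ α ∈ s, coeff α g • monomial α (1 : R)), map_add, map_sum]
    refine add_mem ?_ (sum_mem fun α _ => ?_)
    · rw [hT]
      exact sub_mem (sub_mem (hφW hs) hs) (weightFiltration_anti (Nat.le_add_right _ _) (hDW hs))
    · rw [map_smul]
      by_cases h0 : coeff α g = 0
      · rw [h0, zero_smul]
        exact zero_mem _
      · exact smul_mem_weightFiltration _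
          (weightFiltration_anti (Nat.add_le_add_right (hg α h0) _) (hTmon α))
  rwa [hT, hD, hφ, substAlgHom_apply] at hmain

lemma subst_sub_mem_weightFiltration (hW : ∀ i, W i ≠ 0) {a : σ → MvPowerSeries σ R}
    (ha : HasSubst a) (h : ∀ i, a i - X i ∈ weightFiltration W (W i + e))
    {g : MvPowerSeries σ R} (hg : g ∈ weightFiltration W d) :
    subst a g - g ∈ weightFiltration W (d + e) := by
  have := add_mem (weightFiltration_anti (by omega)
    (subst_sub_sub_mem_weightFiltration hW ha h hg)) (sum_mul_pderiv_mem_weightFiltration h hg)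
  rwa [sub_add_cancel] at this

/-- A substitution `x_i ↦ x_i + h_i` which raises the weighted order of each variable is an
automorphism of the power series ring. -/
lemma exists_algEquiv_eq_subst (hW : ∀ i, W i ≠ 0) {a : σ → MvPowerSeries σ R}
    (he : 1 ≤ e) (h : ∀ i, a i - X i ∈ weightFiltration W (W i + e)) :
    HasSubst a ∧ ∃ ψ : MvPowerSeries σ R ≃ₐ[R] MvPowerSeries σ R, ∀ p, ψ p = subst a p := by
  have ha : HasSubst a := by
    refine hasSubst_of_constantCoeff_zero fun i => ?_
    have h1 : constantCoeff (a i - X i) = 0 :=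
      coeff_eq_zero_of_mem_weightFiltration (h i) (α := 0) (by rw [map_zero]; omega)
    simpa using h1
  have hbij := bijective_of_sub_mem_weightFiltration W (substAlgHom (R := R) ha) fun d p hp => by
    rw [substAlgHom_apply]
    exact weightFiltration_anti (by omega) (subst_sub_mem_weightFiltration hW ha h hp)
  exact ⟨ha, AlgEquiv.ofBijective _ hbij, fun p => substAlgHom_apply ha p⟩

end Taylor

/-! ### Powers of the maximal ideal -/

section MaxIdeal

variable {n : ℕ} {K : Type*} [Field K]

lemma X_mem_maxIdeal (i : Fin n) : (X i : MvPowerSeries (Fin n) K) ∈ maxIdeal n K :=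
  Ideal.subset_span ⟨i, rfl⟩

/-- A power series without terms of degree at most `d` is `∑ x_i f_i` with `f_i` of order at least
`d`: distribute its monomials according to one of the variables occurring in them. -/
lemma weightFiltration_one_succ_le (d : ℕ) :
    (weightFiltration (fun _ => 1) (d + 1) : Ideal (MvPowerSeries (Fin n) K)) ≤
      maxIdeal n K * weightFiltration (fun _ => 1) d := by
  classical
  intro f hf
  obtain _ | _ := isEmpty_or_nonempty (Fin n)
  · have : f = 0 := by
      ext α
      exact coeff_eq_zero_of_mem_weightFiltration hf (by simp [Subsingleton.elim α 0])
    rw [this]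
    exact zero_mem _
  have hvar : ∀ α : Fin n →₀ ℕ, α ≠ 0 → ∃ i, α i ≠ 0 := fun α hα => by
    by_contra! h
    exact hα (Finsupp.ext h)
  choose! c hc using hvar
  let q : Fin n → MvPowerSeries (Fin n) K := fun i γ =>
    if c (γ + single i 1) = i then coeff (γ + single i 1) f else 0
  have hq : ∀ i γ, coeff γ (q i) =
    if c (γ + single i 1) = i then coeff (γ + single i 1) f else 0 := fun _ _ => rfl
  have hsum : f = ∑ i, X i * q i := by
    ext α
    rw [map_sum]
    by_cases hα : α = 0
    · subst hα
      rw [coeff_eq_zero_of_mem_weightFiltration hf (by simp)]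
      simp
    · have hle : ∀ i, α i ≠ 0 → single i 1 ≤ α := fun i hi => by
        rw [single_le_iff]
        omega
      have hterm : ∀ i, coeff α (X i * q i) = if c α = i then coeff α f else 0 := by
        intro i
        rw [X, coeff_monomial_mul, one_mul]
        by_cases hi : α i = 0
        · rw [if_neg, if_neg]
          · rintro rfl
            exact hc α hα hi
          · rw [single_le_iff]
            omega
        · rw [if_pos (hle i hi), hq, tsub_add_cancel_of_le (hle i hi)]
      simp only [hterm, Finset.sum_ite_eq, Finset.mem_univ, if_true]
  rw [hsum]
  refine sum_mem fun i _ => Ideal.mul_mem_mul (X_mem_maxIdeal i) fun γ hγ => ?_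
  have h1 : coeff (γ + single i 1) f ≠ 0 := by
    intro h0
    rw [hq, h0, ite_self] at hγ
    exact hγ rfl
  have h2 := hf _ h1
  rw [map_add, weight_single, one_smul] at h2
  omega

lemma maxIdeal_pow_eq (d : ℕ) :
    maxIdeal n K ^ d = weightFiltration (fun _ => 1) d := by
  have hone : maxIdeal n K ≤ weightFiltration (fun _ => 1) 1 := by
    refine Ideal.span_le.2 ?_
    rintro _ ⟨i, rfl⟩
    exact monomial_mem_weightFiltration _ (by rw [weight_single, one_smul])
  induction d with
  | zero =>
    rw [pow_zero, Ideal.one_eq_top, eq_comm, Ideal.eq_top_iff_one]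
    exact mem_weightFiltration_zero 1
  | succ d ih =>
    refine le_antisymm ?_ ((weightFiltration_one_succ_le d).trans_eq (by rw [← ih, ← pow_succ']))
    rw [pow_succ, ih]
    exact Ideal.mul_le.2 fun p hp q hq => mul_mem_weightFiltration hp (hone hq)

lemma mem_maxIdeal_pow_iff {f : MvPowerSeries (Fin n) K} {d : ℕ} :
    f ∈ maxIdeal n K ^ d ↔ (d : ℕ∞) ≤ f.order := by
  rw [maxIdeal_pow_eq]
  exact mem_weightFiltration_one_iff_le_order

lemma mem_maxIdeal_iff {f : MvPowerSeries (Fin n) K} :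
    f ∈ maxIdeal n K ↔ constantCoeff f = 0 := by
  rw [← pow_one (maxIdeal n K), mem_maxIdeal_pow_iff, Nat.cast_one,
    one_le_order_iff_constCoeff_eq_zero]

/-- Every `K`-algebra automorphism of the power series ring is local. -/
lemma map_maxIdeal_le (φ : MvPowerSeries (Fin n) K ≃ₐ[K] MvPowerSeries (Fin n) K) :
    (maxIdeal n K).map φ ≤ maxIdeal n K := by
  refine Ideal.map_le_iff_le_comap.2 fun p hp => ?_
  rw [Ideal.mem_comap]
  rw [mem_maxIdeal_iff] at hp ⊢
  by_contra h
  have h1 : IsUnit (φ p) := isUnit_iff_constantCoeff.2 (isUnit_iff_ne_zero.2 h)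
  rw [MulEquiv.isUnit_map, isUnit_iff_constantCoeff, hp] at h1
  exact not_isUnit_zero h1

lemma apply_mem_maxIdeal_pow (φ : MvPowerSeries (Fin n) K ≃ₐ[K] MvPowerSeries (Fin n) K)
    {p : MvPowerSeries (Fin n) K} {d : ℕ} (hp : p ∈ maxIdeal n K ^ d) :
    φ p ∈ maxIdeal n K ^ d := by
  have h := Ideal.mem_map_of_mem φ hp
  rw [Ideal.map_pow] at h
  exact Ideal.pow_right_mono (map_maxIdeal_le φ) d h

end MaxIdeal

/-! ### Derivations and the Jacobian ideal -/

section Jacobian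

variable {n : ℕ} {K : Type*} [Field K]

lemma derivation_mem_maxIdeal_pow
    (ξ : Derivation K (MvPowerSeries (Fin n) K) (MvPowerSeries (Fin n) K)) (d : ℕ) :
    ∀ p ∈ maxIdeal n K ^ (d + 1), ξ p ∈ maxIdeal n K ^ d := by
  induction d with
  | zero => simp
  | succ d ih =>
    intro p hp
    rw [pow_succ'] at hp
    induction hp using Submodule.mul_induction_on' with
    | mem_mul_mem a ha b hb =>
      rw [Derivation.leibniz, smul_eq_mul, smul_eq_mul]
      refine add_mem ?_ (Ideal.mul_mem_right _ _ hb)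
      rw [pow_succ']
      exact Ideal.mul_mem_mul ha (ih b hb)
    | add a _ b _ ha hb =>
      rw [map_add]
      exact add_mem ha hb

/-- A `K`-derivation of the power series ring is continuous for the `𝔪`-adic topology, and hence
determined by its values on the variables. -/
lemma derivation_apply_eq_sum
    (ξ : Derivation K (MvPowerSeries (Fin n) K) (MvPowerSeries (Fin n) K))
    (p : MvPowerSeries (Fin n) K) : ξ p = ∑ i, ξ (X i) * pderiv K i p := by
  let D : Derivation K (MvPowerSeries (Fin n) K) (MvPowerSeries (Fin n) K) :=
    ξ - ∑ i, ξ (X i) • pderiv K i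
  have hD : ∀ q, D q = ξ q - ∑ i, ξ (X i) * pderiv K i q := by
    intro q
    change ξ q - Derivation.coeFnAddMonoidHom (∑ i, ξ (X i) • pderiv K i) q = _
    rw [map_sum, Finset.sum_apply]
    rfl
  have hX : ∀ i, D (X i) = 0 := by
    intro i
    rw [hD, Finset.sum_eq_single i]
    · simp
    · intro j _ hj
      rw [pderiv_X_of_ne hj.symm, mul_zero]
    · simp
  have hstep : ∀ α β, D (monomial α 1) = 0 → D (monomial β 1) = 0 →
      D (monomial (α + β) 1) = 0 := by
    intro α β hα hβ
    rw [← one_mul (1 : K), ← monomial_mul_monomial, Derivation.leibniz, hα, hβ]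
    simp
  have hmon : ∀ α, D (monomial α 1) = 0 := by
    intro α
    induction α using Finsupp.induction_linear with
    | zero => exact D.map_one_eq_zero
    | add α β hα hβ => exact hstep α β hα hβ
    | single i k =>
      induction k with
      | zero => rw [single_zero]; exact D.map_one_eq_zero
      | succ k ih => rw [single_add]; exact hstep _ _ ih (hX i)
  rw [← sub_eq_zero, ← hD]
  refine eq_zero_of_forall_mem_weightFiltration (W := fun _ => 1) fun d => ?_
  obtain ⟨s, hs⟩ := exists_polynomial_sub_mem_weightFiltration (W := fun _ : Fin n => 1)
    (fun _ => one_ne_zero) p (d + 1)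
  rw [← maxIdeal_pow_eq] at hs ⊢
  have h := derivation_mem_maxIdeal_pow D d _ hs
  rw [map_sub, map_sum, Finset.sum_eq_zero, sub_zero] at h
  · exact h
  · intro α _
    rw [Derivation.map_smul, hmon, smul_zero]

lemma derivation_apply_mem_jacobianIdeal
    (ξ : Derivation K (MvPowerSeries (Fin n) K) (MvPowerSeries (Fin n) K))
    (f : MvPowerSeries (Fin n) K) : ξ f ∈ jacobianIdeal f := by
  rw [derivation_apply_eq_sum]
  exact sum_mem fun i _ => Ideal.mul_mem_left _ _ (Ideal.subset_span ⟨i, rfl⟩)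

/-- The Jacobian ideal is the set of all `ξ f`, `ξ` a derivation, and derivations can be transported
along an automorphism. -/
lemma map_jacobianIdeal_le (φ : MvPowerSeries (Fin n) K ≃ₐ[K] MvPowerSeries (Fin n) K)
    (f : MvPowerSeries (Fin n) K) : (jacobianIdeal f).map φ ≤ jacobianIdeal (φ f) := by
  refine Ideal.map_le_iff_le_comap.2 (Ideal.span_le.2 ?_)
  rintro _ ⟨i, rfl⟩
  let ξ : Derivation K (MvPowerSeries (Fin n) K) (MvPowerSeries (Fin n) K) :=
    Derivation.mk' (φ.toLinearMap ∘ₗ (pderiv K i).toLinearMap ∘ₗ φ.symm.toLinearMap) fun a b => by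
      simp
  have h : ξ (φ f) = φ (pderiv K i f) := by
    change φ (pderiv K i (φ.symm (φ f))) = _
    rw [AlgEquiv.symm_apply_apply]
  change φ (pderiv K i f) ∈ jacobianIdeal (φ f)
  rw [← h]
  exact derivation_apply_mem_jacobianIdeal ξ (φ f)

lemma maxIdeal_pow_le_apply {f : MvPowerSeries (Fin n) K} {k : ℕ}
    (hk : maxIdeal n K ^ (k + 2) ≤ maxIdeal n K ^ 2 * jacobianIdeal f)
    (φ : MvPowerSeries (Fin n) K ≃ₐ[K] MvPowerSeries (Fin n) K) :
    maxIdeal n K ^ (k + 2) ≤ maxIdeal n K ^ 2 * jacobianIdeal (φ f) := by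
  intro p hp
  have h := Ideal.mem_map_of_mem φ (hk (apply_mem_maxIdeal_pow φ.symm hp))
  rw [AlgEquiv.apply_symm_apply, Ideal.map_mul, Ideal.map_pow] at h
  exact Ideal.mul_mono (Ideal.pow_right_mono (map_maxIdeal_le φ) 2) (map_jacobianIdeal_le φ f) h

/-- As `𝔪 ^ 2 * j(f)` has order greater than `f`, the order of `f` is at most `k + 1`. -/
lemma le_of_mem_maxIdeal_pow (hn : 1 ≤ n) {f : MvPowerSeries (Fin n) K} {k : ℕ}
    (hk : maxIdeal n K ^ (k + 2) ≤ maxIdeal n K ^ 2 * jacobianIdeal f) {d : ℕ}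
    (hd : f ∈ maxIdeal n K ^ d) : d ≤ k + 1 := by
  obtain _ | d := d
  · exact Nat.zero_le _
  have hj : jacobianIdeal f ≤ maxIdeal n K ^ d := by
    refine Ideal.span_le.2 ?_
    rintro _ ⟨i, rfl⟩
    exact derivation_mem_maxIdeal_pow _ d f hd
  have h1 : (X ⟨0, hn⟩ : MvPowerSeries (Fin n) K) ^ (k + 2) ∈ maxIdeal n K ^ (2 + d) := by
    rw [pow_add]
    exact Ideal.mul_mono_right hj (hk (Ideal.pow_mem_pow (X_mem_maxIdeal _) _))
  rw [maxIdeal_pow_eq, X_pow_eq] at h1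
  have h2 := h1 (single ⟨0, hn⟩ (k + 2)) (by rw [coeff_monomial_same]; exact one_ne_zero)
  rw [weight_single] at h2
  simp only [smul_eq_mul, mul_one] at h2
  omega

end Jacobian

/-! ### Finite determinacy -/

section Determinacy

variable {n : ℕ} {K : Type*} [Field K]

/-- One Newton step: if `g - f` is of high order, write it as `∑ h_i ∂f/∂x_i`; the substitution
`x_i ↦ x_i + h_i` brings `f` one order closer to `g`. -/
lemma exists_algEquiv_sub_mem {f g : MvPowerSeries (Fin n) K} {k o c j : ℕ}
    (hk : maxIdeal n K ^ (k + 2) ≤ maxIdeal n K ^ 2 * jacobianIdeal f)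
    (ho : f ∈ maxIdeal n K ^ o) (hc : o + c = k + 1)
    (hfg : g - f ∈ maxIdeal n K ^ (k + 2 + c + j)) :
    ∃ ψ : MvPowerSeries (Fin n) K ≃ₐ[K] MvPowerSeries (Fin n) K,
      (∀ d, ∀ p ∈ maxIdeal n K ^ d, ψ p - p ∈ maxIdeal n K ^ (d + (c + j + 1))) ∧
      g - ψ f ∈ maxIdeal n K ^ (k + 2 + c + (j + 1)) := by
  have h1 : g - f ∈ maxIdeal n K ^ (1 + (c + j + 1)) * jacobianIdeal f := by
    rw [show k + 2 + c + j = (c + j) + (k + 2) by ring, pow_add] at hfg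
    have := Ideal.mul_mono_right hk hfg
    rwa [← mul_assoc, ← pow_add, show c + j + 2 = 1 + (c + j + 1) by ring] at this
  rw [jacobianIdeal, ← smul_eq_mul, Submodule.mem_ideal_smul_span_iff_exists_sum] at h1
  obtain ⟨h, hh, hsum⟩ := h1
  rw [Finsupp.sum_fintype _ _ (by simp)] at hsum
  simp only [smul_eq_mul] at hsum
  have hW : ∀ i : Fin n, (fun _ : Fin n => 1) i ≠ 0 := fun _ => one_ne_zero
  have ha : ∀ i, (X i + h i) - X i ∈
      weightFiltration (R := K) (fun _ : Fin n => 1) (1 + (c + j + 1)) := by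
    intro i
    rw [add_sub_cancel_left, ← maxIdeal_pow_eq]
    exact hh i
  obtain ⟨hsubst, ψ, hψ⟩ := exists_algEquiv_eq_subst hW (a := fun i => X i + h i)
    (Nat.le_add_left 1 (c + j)) ha
  simp only [maxIdeal_pow_eq] at ho ⊢
  refine ⟨ψ, fun d p hp => ?_, ?_⟩
  · rw [hψ]
    exact subst_sub_mem_weightFiltration hW hsubst ha hp
  · have h2 := subst_sub_sub_mem_weightFiltration hW hsubst ha ho
    simp only [add_sub_cancel_left, hsum] at h2
    rw [sub_sub_sub_cancel_right, ← neg_mem_iff, neg_sub] at h2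
    rw [hψ]
    exact weightFiltration_anti (by omega) h2

/-- **Finite determinacy** with respect to right equivalence: if `𝔪 ^ (k + 2) ⊆ 𝔪 ^ 2 * j(f)`, then
`f` is right `(2 * k - ord f + 2)`-determined. -/
theorem rightEquivalent_of_sub_mem {f g : MvPowerSeries (Fin n) K} {k o c : ℕ}
    (hk : maxIdeal n K ^ (k + 2) ≤ maxIdeal n K ^ 2 * jacobianIdeal f)
    (ho : f ∈ maxIdeal n K ^ o) (hc : o + c = k + 1)
    (hfg : g - f ∈ maxIdeal n K ^ (k + 2 + c)) : RightEquivalent f g := by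
  let P : ℕ → (MvPowerSeries (Fin n) K ≃ₐ[K] MvPowerSeries (Fin n) K) → Prop := fun j Φ =>
    g - Φ f ∈ maxIdeal n K ^ (k + 2 + c + j) ∧
      ∀ d, ∀ p ∈ maxIdeal n K ^ d, Φ p - p ∈ maxIdeal n K ^ (d + 1)
  have hstep : ∀ j Φ, P j Φ → ∃ Φ', P (j + 1) Φ' ∧
      ∀ p, Φ' p - Φ p ∈ maxIdeal n K ^ (j + 1) := by
    rintro j Φ ⟨hΦ, hΦd⟩
    obtain ⟨ψ, hψd, hψ⟩ := exists_algEquiv_sub_mem (maxIdeal_pow_le_apply hk Φ)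
      (apply_mem_maxIdeal_pow Φ ho) hc hΦ
    refine ⟨Φ.trans ψ, ⟨hψ, fun d p hp => ?_⟩, fun p => ?_⟩
    · have h1 := hψd d _ (apply_mem_maxIdeal_pow Φ hp)
      have h2 := add_mem (Ideal.pow_le_pow_right (by omega) h1) (hΦd d p hp)
      rwa [sub_add_sub_cancel] at h2
    · exact Ideal.pow_le_pow_right (by omega) (hψd 0 (Φ p) (by simp))
  choose! S hS hS' using hstep
  let Φ : ℕ → MvPowerSeries (Fin n) K ≃ₐ[K] MvPowerSeries (Fin n) K :=
    fun j => Nat.rec AlgEquiv.refl S j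
  have hΦ : ∀ j, P j (Φ j) := by
    intro j
    induction j with
    | zero => exact ⟨hfg, fun d p _ => by simp [Φ]⟩
    | succ j ih => exact hS j _ ih
  obtain ⟨Ψ, hΨ⟩ : ∃ Ψ : MvPowerSeries (Fin n) K →ₐ[K] MvPowerSeries (Fin n) K,
      ∀ j p, Ψ p - Φ j p ∈ weightFiltration (fun _ => 1) (j + 1) := by
    refine exists_algHom_limit (fun _ => 1) (fun j => (Φ j).toAlgHom) fun j p => ?_
    rw [← maxIdeal_pow_eq]
    exact hS' j _ (hΦ j) p
  have hbij : Function.Bijective Ψ := by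
    refine bijective_of_sub_mem_weightFiltration (fun _ => 1) Ψ fun d p hp => ?_
    rw [← maxIdeal_pow_eq] at hp
    have h := (hΦ d).2 d p hp
    rw [maxIdeal_pow_eq] at h
    have h' := add_mem (hΨ d p) h
    rwa [sub_add_sub_cancel] at h'
  have hΨf : Ψ f = g := by
    refine eq_of_forall_sub_mem_weightFiltration (W := fun _ => 1) fun d => ?_
    have h := (hΦ d).1
    rw [maxIdeal_pow_eq] at h
    have h' := add_mem (weightFiltration_anti (Nat.le_succ d) (hΨ d f))
      (neg_mem (weightFiltration_anti (Nat.le_add_left d _) h))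
    rwa [neg_sub, sub_add_sub_cancel] at h'
  refine ⟨(AlgEquiv.ofBijective Ψ hbij).symm, ?_⟩
  rw [eq_comm, AlgEquiv.symm_apply_eq, AlgEquiv.coe_ofBijective, hΨf]

end Determinacy

/-! ### Piecewise valuations as minima of weighted orders -/

namespace CPolytope

variable {n : ℕ} (P : CPolytope n)

lemma N_pos : 0 < P.N := by
  refine Nat.pos_of_ne_zero fun h => ?_
  obtain ⟨w, _, hw⟩ := Finset.lcm_eq_zero_iff.1 h
  obtain ⟨j, _, hj⟩ := Finset.lcm_eq_zero_iff.1 hw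
  exact (w j).den_ne_zero hj

/-- The vector `N_P · w` of a weight vector `w` of `P`, which has positive integral entries. -/
def intWeight (w : Fin n → ℚ) (j : Fin n) : ℕ := ⌊(P.N : ℚ) * w j⌋₊

lemma intWeight_cast {w : Fin n → ℚ} (hw : w ∈ P.weights) (j : Fin n) :
    (P.intWeight w j : ℝ) = P.N * w j := by
  obtain ⟨c, hc⟩ : (w j).den ∣ P.N :=
    (Finset.dvd_lcm (f := fun j => (w j).den) (Finset.mem_univ j)).trans
      (Finset.dvd_lcm (f := fun w : Fin n → ℚ => Finset.univ.lcm fun j => (w j).den) hw)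
  have h : (P.N : ℚ) * w j = (c * (w j).num.toNat : ℕ) := by
    have h1 : (((w j).num.toNat : ℕ) : ℚ) = (w j).num := by
      exact_mod_cast Int.toNat_of_nonneg (Rat.num_pos.2 (P.pos w hw j)).le
    rw [hc]
    push_cast
    rw [h1, mul_right_comm, Rat.den_mul_eq_num, mul_comm]
  have h2 : (P.intWeight w j : ℚ) = P.N * w j := by
    rw [intWeight, h, Nat.floor_natCast]
  exact_mod_cast h2

lemma intWeight_ne_zero {w : Fin n → ℚ} (hw : w ∈ P.weights) (j : Fin n) :
    P.intWeight w j ≠ 0 := by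
  have h : (0 : ℝ) < P.intWeight w j := by
    rw [P.intWeight_cast hw]
    exact mul_pos (Nat.cast_pos.2 P.N_pos) (Rat.cast_pos.2 (P.pos w hw j))
  exact (Nat.cast_pos.1 h).ne'

lemma le_val_iff {x : ℝ} {r : Fin n → ℝ} :
    x ≤ P.val r ↔ ∀ w ∈ P.weights, x ≤ ∑ j, (P.intWeight w j : ℝ) * r j := by
  have h : ∀ w ∈ P.weights, ∑ j, (P.intWeight w j : ℝ) * r j = P.N * ∑ j, (w j : ℝ) * r j := by
    intro w hw
    rw [Finset.mul_sum]
    exact Finset.sum_congr rfl fun j _ => by rw [P.intWeight_cast hw, mul_assoc]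
  constructor
  · intro hx w hw
    rw [h w hw]
    exact hx.trans (mul_le_mul_of_nonneg_left (Finset.inf'_le _ hw) (Nat.cast_nonneg _))
  · intro hx
    obtain ⟨w, hw, hmin⟩ := Finset.exists_mem_eq_inf' P.nonempty
      fun w : Fin n → ℚ => ∑ j, (w j : ℝ) * r j
    rw [val, lam, hmin, ← h w hw]
    exact hx w hw

lemma weight_intWeight_cast (w : Fin n → ℚ) (α : Fin n →₀ ℕ) :
    ((weight (P.intWeight w) α : ℕ) : ℝ) = ∑ j, (P.intWeight w j : ℝ) * (α j : ℝ) := by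
  rw [weight_eq_sum]
  push_cast
  exact Finset.sum_congr rfl fun j _ => by rw [smul_eq_mul, Nat.cast_mul, mul_comm]

lemma le_natVal_iff {d : ℕ} {α : Fin n →₀ ℕ} :
    d ≤ P.natVal α ↔ ∀ w ∈ P.weights, d ≤ weight (P.intWeight w) α := by
  rw [← Nat.cast_le (α := ℝ), natVal_cast, valExp, le_val_iff]
  refine forall₂_congr fun w _ => ?_
  rw [← weight_intWeight_cast, Nat.cast_le]

lemma le_weight_of_le_valDer {e : ℕ} {i : Fin n} {α : Fin n →₀ ℕ} (h : (e : ℝ) ≤ P.valDer i α)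
    {w : Fin n → ℚ} (hw : w ∈ P.weights) : P.intWeight w i + e ≤ weight (P.intWeight w) α := by
  have h1 := P.le_val_iff.1 h w hw
  simp only [mul_sub, Finset.sum_sub_distrib, mul_ite, mul_one, mul_zero, Finset.sum_ite_eq',
    Finset.mem_univ, if_true] at h1
  rw [← weight_intWeight_cast] at h1
  rw [← Nat.cast_le (α := ℝ)]
  push_cast
  linarith

lemma lam_le_lam_iff {α β : Fin n →₀ ℕ} :
    P.lam (fun j => (α j : ℝ)) ≤ P.lam (fun j => (β j : ℝ)) ↔ P.natVal α ≤ P.natVal β := by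
  rw [← Nat.cast_le (α := ℝ), natVal_cast, natVal_cast, valExp, valExp, val, val,
    mul_le_mul_iff_right₀ (Nat.cast_pos.2 P.N_pos)]

variable {K : Type*} [Field K] {f : MvPowerSeries (Fin n) K} {d : ℕ}

lemma le_v_iff : ((d : ℝ) : EReal) ≤ P.v f ↔ ∀ α, coeff α f ≠ 0 → d ≤ P.natVal α := by
  rw [v, le_iInf₂_iff]
  refine forall₂_congr fun α _ => ?_
  rw [← natVal_cast, EReal.coe_le_coe_iff, Nat.cast_le]

lemma mem_F_iff : f ∈ P.F K d ↔ ∀ α, coeff α f ≠ 0 → d ≤ P.natVal α := P.le_v_iff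

/-- The filtration of `P` is the intersection of the filtrations by weighted order of its facets.
This reduces estimates for the piecewise valuation, which is only superadditive on exponents, to
linear weights. -/
lemma mem_F_iff_forall_weights :
    f ∈ P.F K d ↔ ∀ w ∈ P.weights, f ∈ weightFiltration (P.intWeight w) d := by
  rw [mem_F_iff]
  simp only [le_natVal_iff, mem_weightFiltration]
  exact ⟨fun h w hw α hα => h α hα w hw, fun h α hα w hw => h w hw α hα⟩

lemma F_anti {e : ℕ} (h : d ≤ e) : P.F K e ≤ P.F K d := fun _ hf =>
  P.mem_F_iff.2 fun α hα => h.trans (P.mem_F_iff.1 hf α hα)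

lemma exists_natVal_eq_v (hf : f ≠ 0) :
    ∃ α, coeff α f ≠ 0 ∧ P.v f = ((P.natVal α : ℝ) : EReal) := by
  have hne : {α | coeff α f ≠ 0}.Nonempty := by
    by_contra h
    rw [Set.not_nonempty_iff_eq_empty] at h
    refine hf (MvPowerSeries.ext fun α => ?_)
    by_contra hα
    exact (h ▸ (show α ∈ {α | coeff α f ≠ 0} from hα) : α ∈ (∅ : Set (Fin n →₀ ℕ)))
  have hmem := Function.argminOn_mem P.natVal _ hne
  refine ⟨_, hmem, le_antisymm ?_ (P.le_v_iff.2 fun β hβ => Function.argminOn_le P.natVal _ hβ)⟩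
  rw [natVal_cast]
  exact iInf₂_le _ hmem

lemma coeff_initialForm (hd : P.v f = ((d : ℝ) : EReal)) (α : Fin n →₀ ℕ) :
    coeff α (P.initialForm f) = if P.natVal α ≤ d then coeff α f else 0 := by
  have hf : f ≠ 0 := by
    rintro rfl
    exact EReal.coe_ne_top _ (hd.symm.trans P.v_zero)
  obtain ⟨β, hβ, hv⟩ := P.exists_natVal_eq_v hf
  have hβd : P.natVal β = d := by
    rw [hd] at hv
    exact_mod_cast hv.symm
  have hiff : (∀ β, coeff β f ≠ 0 → P.lam (fun j => (α j : ℝ)) ≤ P.lam (fun j => (β j : ℝ))) ↔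
      P.natVal α ≤ d := by
    simp only [lam_le_lam_iff]
    exact ⟨fun h => hβd ▸ h β hβ, fun h γ hγ => h.trans (P.le_v_iff.1 hd.ge γ hγ)⟩
  exact ite_congr (propext hiff) (fun _ => rfl) (fun _ => rfl)

lemma v_initialForm (hd : P.v f = ((d : ℝ) : EReal)) :
    P.v (P.initialForm f) = ((d : ℝ) : EReal) := by
  have hf : f ≠ 0 := by
    rintro rfl
    exact EReal.coe_ne_top _ (hd.symm.trans P.v_zero)
  obtain ⟨β, hβ, hv⟩ := P.exists_natVal_eq_v hf
  have hβd : P.natVal β = d := by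
    rw [hd] at hv
    exact_mod_cast hv.symm
  refine le_antisymm ?_ (P.le_v_iff.2 fun α hα => ?_)
  · rw [← hd, hv, natVal_cast]
    exact iInf₂_le β (by rwa [P.coeff_initialForm hd, if_pos hβd.le])
  · rw [P.coeff_initialForm hd] at hα
    exact P.le_v_iff.1 hd.ge α fun h => hα (by rw [h, ite_self])

lemma sub_initialForm_mem_F (hd : P.v f = ((d : ℝ) : EReal)) :
    f - P.initialForm f ∈ P.F K (d + 1) := by
  refine P.mem_F_iff.2 fun α hα => ?_
  rw [map_sub, P.coeff_initialForm hd] at hα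
  by_contra! h
  exact hα (by rw [if_pos (Nat.lt_succ_iff.1 h), sub_self])

/-- The degree `d` part of the graded space is spanned by the monomials of degree `d` of a regular
basis: modulo these, every element of `F_d` lies in `j_P^A(f)_d + F_{d+1}`. -/
lemma exists_sub_mem_of_isRegularBasis {Λ : Set (Fin n →₀ ℕ)} (hΛ : P.IsRegularBasis f Λ)
    {h : MvPowerSeries (Fin n) K} (hh : h ∈ P.F K d) :
    ∃ g : MvPowerSeries (Fin n) K, (∀ α, coeff α g ≠ 0 → α ∈ Λ ∧ P.natVal α = d) ∧
      h - g ∈ P.jA f d ⊔ P.F K (d + 1) := by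
  classical
  have key : ∀ z ∈ Submodule.span K (Set.range fun α : Λ => P.monomialClass f α),
      ∃ (g : MvPowerSeries (Fin n) K) (hg : g ∈ P.F K d),
        (∀ α, coeff α g ≠ 0 → α ∈ Λ ∧ P.natVal α = d) ∧
        z d = Submodule.Quotient.mk ⟨g, hg⟩ := by
    intro z hz
    induction hz using Submodule.span_induction with
    | mem z hz =>
      obtain ⟨⟨α, hα⟩, rfl⟩ := hz
      by_cases hd : P.natVal α = d
      · subst hd
        refine ⟨monomial α 1, (P.v_monomial_one α).ge, fun β hβ => ?_, ?_⟩
        · rw [coeff_monomial] at hβ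
          by_cases hβα : β = α
          · subst hβα
            exact ⟨hα, rfl⟩
          · rw [if_neg hβα] at hβ
            exact absurd rfl hβ
        · exact DirectSum.lof_apply K (P.natVal α) _
      · refine ⟨0, zero_mem _, fun β hβ => absurd (map_zero _) hβ, ?_⟩
        exact DirectSum.of_eq_of_ne _ _ _ (Ne.symm hd)
    | zero => exact ⟨0, zero_mem _, fun β hβ => absurd (map_zero _) hβ, rfl⟩
    | add x y _ _ hx hy =>
      obtain ⟨g, hg, hgΛ, hgx⟩ := hx
      obtain ⟨g', hg', hgΛ', hgy⟩ := hy
      refine ⟨g + g', add_mem hg hg', fun α hα => ?_, ?_⟩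
      · by_cases h0 : coeff α g = 0
        · exact hgΛ' α fun h1 => hα (by rw [map_add, h0, h1, add_zero])
        · exact hgΛ α h0
      · rw [DirectSum.add_apply, hgx, hgy]
        rfl
    | smul c x _ hx =>
      obtain ⟨g, hg, hgΛ, hgx⟩ := hx
      have hcg : c • g ∈ P.F K d := by
        rw [smul_eq_C_mul]
        exact Ideal.mul_mem_left _ _ hg
      refine ⟨c • g, hcg, fun α hα => hgΛ α fun h1 => hα ?_, ?_⟩
      · rw [coeff_smul, h1, mul_zero]
      · rw [DirectSum.smul_apply, hgx]
        rfl
  obtain ⟨g, hg, hgΛ, hgz⟩ := key (DirectSum.lof K ℕ (fun d => P.grPiece f d) d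
    (Submodule.Quotient.mk ⟨h, hh⟩)) (by rw [hΛ.2]; exact Submodule.mem_top)
  refine ⟨g, hgΛ, ?_⟩
  rw [DirectSum.lof_apply, Submodule.Quotient.eq] at hgz
  exact hgz

lemma mem_weightFiltration_of_le_vDer
    {ξ : Derivation K (MvPowerSeries (Fin n) K) (MvPowerSeries (Fin n) K)} {e : ℕ}
    (h : ((e : ℝ) : EReal) ≤ P.vDer ξ) {w : Fin n → ℚ} (hw : w ∈ P.weights) (i : Fin n) :
    ξ (X i) ∈ weightFiltration (P.intWeight w) (P.intWeight w i + e) := by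
  intro α hα
  refine P.le_weight_of_le_valDer ?_ hw
  exact_mod_cast h.trans ((iInf_le _ i).trans (iInf₂_le α hα))

end CPolytope

/-! ### Reduction to normal form -/

namespace CPolytope

variable {n : ℕ} (P : CPolytope n) {K : Type*} [Field K]

/-- One step of the reduction to normal form: an error term of value `D` is replaced by monomials of
the regular basis and an error term of value greater than `D`.  The automorphism used is
`x_i ↦ x_i - ξ x_i`, where `ξ q` is the part of the error term in `j_P^A(q)_D`. -/
lemma exists_algEquiv_sub_mem_F {Λ : Set (Fin n →₀ ℕ)} {q f g : MvPowerSeries (Fin n) K}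
    (hΛ : P.IsRegularBasis q Λ) {m D : ℕ} (hq : P.v q = ((m : ℝ) : EReal)) (hD : m < D)
    (hg : g ∈ P.F K (m + 1)) (hf : f - (q + g) ∈ P.F K D) :
    ∃ (ψ : MvPowerSeries (Fin n) K ≃ₐ[K] MvPowerSeries (Fin n) K) (g' : MvPowerSeries (Fin n) K),
      (∀ α, coeff α g' ≠ 0 → α ∈ Λ ∧ P.natVal α = D) ∧
      ψ f - (q + (g + g')) ∈ P.F K (D + 1) := by
  obtain ⟨g', hg', hmem⟩ := P.exists_sub_mem_of_isRegularBasis hΛ hf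
  obtain ⟨_, ⟨ξ, hξ, rfl⟩, r, hr, hsum⟩ := Submodule.mem_sup.1 hmem
  obtain ⟨e, rfl⟩ := Nat.exists_eq_add_of_lt hD
  have hξe : (((e + 1 : ℕ) : ℝ) : EReal) ≤ P.vDer ξ := by
    rw [hq] at hξ
    have h := EReal.sub_le_of_le_add hξ
    rw [← EReal.coe_sub] at h
    convert h using 2
    push_cast
    ring
  have hfq : f - q ∈ P.F K (m + 1) := by
    have := add_mem (P.F_anti (by omega) hf) hg
    rwa [← sub_sub, sub_add_cancel] at this
  have hfm : f ∈ P.F K m := by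
    have := add_mem (P.F_anti (Nat.le_succ m) hfq) (show q ∈ P.F K m from hq.ge)
    rwa [sub_add_cancel] at this
  have ha : ∀ w ∈ P.weights, ∀ i, (X i - ξ (X i)) - X i ∈
      weightFiltration (P.intWeight w) (P.intWeight w i + (e + 1)) := by
    intro w hw i
    rw [sub_sub_cancel_left]
    exact neg_mem (P.mem_weightFiltration_of_le_vDer hξe hw i)
  obtain ⟨w₀, hw₀⟩ := P.nonempty
  obtain ⟨hsubst, ψ, hψ⟩ := exists_algEquiv_eq_subst (P.intWeight_ne_zero hw₀)
    (a := fun i => X i - ξ (X i)) (Nat.le_add_left 1 e) (ha w₀ hw₀)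
  refine ⟨ψ, g', hg', P.mem_F_iff_forall_weights.2 fun w hw => ?_⟩
  have hT := subst_sub_sub_mem_weightFiltration (P.intWeight_ne_zero hw) hsubst (ha w hw)
    (P.mem_F_iff_forall_weights.1 hfm w hw)
  have hξf : ∑ i, ((X i - ξ (X i)) - X i) * pderiv K i f = -ξ f := by
    rw [derivation_apply_eq_sum ξ f, ← Finset.sum_neg_distrib]
    exact Finset.sum_congr rfl fun i _ => by ring
  have hξfq : ξ (f - q) ∈ weightFiltration (P.intWeight w) (m + 1 + (e + 1)) := by
    rw [derivation_apply_eq_sum]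
    exact sum_mul_pderiv_mem_weightFiltration
      (fun i => P.mem_weightFiltration_of_le_vDer hξe hw i)
      (P.mem_F_iff_forall_weights.1 hfq w hw)
  rw [hξf, ← hψ] at hT
  have hsplit : ψ f - (q + (g + g')) = (ψ f - f - -ξ f) - ξ (f - q) + r := by
    rw [eq_sub_of_add_eq' hsum, map_sub]
    ring
  rw [hsplit]
  exact add_mem (sub_mem (weightFiltration_anti (by omega) hT)
    (weightFiltration_anti (by omega) hξfq)) (P.mem_F_iff_forall_weights.1 hr w hw)

/-- Normal form modulo terms of arbitrarily high value. -/
lemma exists_algEquiv_sub_mem_F_add {Λ : Set (Fin n →₀ ℕ)} {q f : MvPowerSeries (Fin n) K}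
    (hΛ : P.IsRegularBasis q Λ) {m d : ℕ} (hq : P.v q = ((m : ℝ) : EReal)) (hd : m < d)
    (hf : f - q ∈ P.F K d) (t : ℕ) :
    ∃ (φ : MvPowerSeries (Fin n) K ≃ₐ[K] MvPowerSeries (Fin n) K) (g : MvPowerSeries (Fin n) K),
      (∀ α, coeff α g ≠ 0 → α ∈ Λ ∧ d ≤ P.natVal α) ∧ φ f - (q + g) ∈ P.F K (d + t) := by
  induction t with
  | zero => exact ⟨AlgEquiv.refl, 0, fun α h => absurd (map_zero _) h, by simpa using hf⟩
  | succ t ih =>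
    obtain ⟨φ, g, hg, hφ⟩ := ih
    obtain ⟨ψ, g', hg', hψ⟩ := P.exists_algEquiv_sub_mem_F hΛ hq (hd.trans_le (Nat.le_add_right d t))
      (P.mem_F_iff.2 fun α hα => hd.trans_le (hg α hα).2) hφ
    refine ⟨φ.trans ψ, g + g', fun α hα => ?_, hψ⟩
    by_cases h0 : coeff α g = 0
    · obtain ⟨h1, h2⟩ := hg' α fun h1 => hα (by rw [map_add, h0, h1, add_zero])
      exact ⟨h1, h2 ▸ Nat.le_add_right d t⟩
    · exact hg α h0

variable (K) in
/-- The filtration of `P` is cofinal in the `𝔪`-adic filtration. -/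
lemma exists_F_le_maxIdeal_pow (M : ℕ) : ∃ D, P.F K D ≤ maxIdeal n K ^ M := by
  obtain ⟨B, hB⟩ := ((finite_of_nat_weight_lt (fun _ : Fin n => 1) (fun _ => one_ne_zero) M).image
    P.natVal).bddAbove
  refine ⟨B + 1, fun f hf => ?_⟩
  rw [maxIdeal_pow_eq]
  intro α hα
  by_contra! h
  exact absurd (P.mem_F_iff.1 hf α hα) (not_le.2 (Nat.lt_succ_of_le (hB ⟨α, h, rfl⟩)))

lemma normalFormExponents_finite (f : MvPowerSeries (Fin n) K) (Λ : Set (Fin n →₀ ℕ)) (k : ℕ) :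
    (P.normalFormExponents f Λ k).Finite := by
  refine (finite_of_degree_le (2 * k + 2)).subset fun α hα => ?_
  have h := le_self_add.trans hα.2.1
  exact_mod_cast h

end CPolytope

end NormalForms

end

theorem theorem4p3 {K : Type*} [Field K] [IsAlgClosed K] {n : ℕ} (hn : 1 ≤ n)
    (P : NormalForms.CPolytope n) (f : MvPowerSeries (Fin n) K)
    (hf : f ∈ NormalForms.maxIdeal n K)
    (Λ : Set (Fin n →₀ ℕ)) (hΛ : P.IsRegularBasis (P.initialForm f) Λ)
    (k : ℕ)
    (hk : NormalForms.maxIdeal n K ^ (k + 2) ≤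
      NormalForms.maxIdeal n K ^ 2 * NormalForms.jacobianIdeal f) :
    ∃ (hfin : (P.normalFormExponents f Λ k).Finite) (c : (Fin n →₀ ℕ) → K),
      NormalForms.RightEquivalent f
        (P.initialForm f + ∑ α ∈ hfin.toFinset, MvPowerSeries.monomial α (c α)) := by
  classical
  open NormalForms NormalForms.CPolytope MvPowerSeries Finsupp in
  refine ⟨P.normalFormExponents_finite f Λ k, ?_⟩
  have hf0 : f ≠ 0 := by
    rintro rfl
    have := le_of_mem_maxIdeal_pow hn hk (zero_mem (maxIdeal n K ^ (k + 2)))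
    omega
  by_cases hin : f - P.initialForm f = 0
  · -- `c = 0`: here `v_P(f - In_P(f)) = ⊤`, so that no exponents are allowed
    refine ⟨0, AlgEquiv.refl, ?_⟩
    simpa using sub_eq_zero.1 hin
  obtain ⟨o, ho⟩ := ENat.ne_top_iff_exists.1 (mt order_eq_top_iff.1 hf0)
  have hfo : f ∈ maxIdeal n K ^ o := mem_maxIdeal_pow_iff.2 ho.le
  obtain ⟨c, hc⟩ := Nat.exists_eq_add_of_le (le_of_mem_maxIdeal_pow hn hk hfo)
  obtain ⟨β, -, hm⟩ := P.exists_natVal_eq_v hf0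
  obtain ⟨γ, hγ, hd⟩ := P.exists_natVal_eq_v hin
  have hmd : P.natVal β < P.natVal γ := P.mem_F_iff.1 (P.sub_initialForm_mem_F hm) γ hγ
  obtain ⟨D, hD⟩ := P.exists_F_le_maxIdeal_pow K (k + 2 + c)
  obtain ⟨φ, g, hg, hφ⟩ := P.exists_algEquiv_sub_mem_F_add hΛ (P.v_initialForm hm) hmd
    (P.mem_F_iff.2 (P.le_v_iff.1 hd.ge)) D
  refine ⟨fun α => coeff α g, ?_⟩
  set s := (P.normalFormExponents_finite f Λ k).toFinset with hs
  have htail : g - ∑ α ∈ s, monomial α (coeff α g) ∈ maxIdeal n K ^ (k + 2 + c) := by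
    rw [maxIdeal_pow_eq]
    intro α hα
    have hsum : coeff α (∑ α ∈ s, monomial α (coeff α g)) = if α ∈ s then coeff α g else 0 := by
      simp only [map_sum, coeff_monomial, Finset.sum_ite_eq]
    rw [map_sub, hsum] at hα
    by_cases hαs : α ∈ s
    · rw [if_pos hαs, sub_self] at hα
      exact absurd rfl hα
    · rw [if_neg hαs, sub_zero] at hα
      obtain ⟨hαΛ, hαd⟩ := hg α hα
      by_contra! hlt
      rw [← degree_eq_weight_one] at hlt
      refine hαs ?_
      rw [hs, Set.Finite.mem_toFinset]
      refine ⟨hαΛ, ?_, ?_⟩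
      · rw [← ho]
        exact_mod_cast (by omega : α.degree + o ≤ 2 * k + 2)
      · rw [hd, P.v_monomial_one]
        exact_mod_cast hαd
  have hclose := add_mem (hD (P.F_anti (Nat.le_add_left D _) hφ)) htail
  obtain ⟨χ, hχ⟩ := rightEquivalent_of_sub_mem
    (g := P.initialForm f + ∑ α ∈ s, monomial α (coeff α g)) (maxIdeal_pow_le_apply hk φ)
    (apply_mem_maxIdeal_pow φ hfo) hc.symm (by
      convert neg_mem hclose using 1
      ring)
  exact ⟨χ.trans φ.symm, by rw [AlgEquiv.trans_apply, ← hχ, AlgEquiv.symm_apply_apply]⟩
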